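/- Let $K$ be a commutative ring with unity, let $M_0$ be a $K$-module with a quadratic form $q_0\colon M_0\to K$ with polar form $b_{q_0}(u,v)=q_0(u+v)-q_0(u)-q_0(v)$, and let $(M,q)$ be a quadratic $K$-module with a fixed decomposition $$M=e_{-2}K\oplus e_{-1}K\oplus M_0\oplus e_1K\oplus e_2K,\qquad q(x_{-2},x_{-1},u,x_1,x_2)=q_0(u)+x_{-1}x_1+x_{-2}x_2,$$ where the $e_iK$ are free of rank one with basis $e_i$. Let $\mathrm{O}(M,q)$ be the group of $K$-linear automorphisms of $M$ preserving $q$. For $i,j\in\{\pm1,\pm2\}$ with $i\neq\pm j$ and $y\in K$ put $$T_{ij}(y)=1+e_{ij}y-e_{-j,-i}y,$$ and for $i\in\{\pm1,\pm2\}$ and $u\in M_0$ put $$T_i(u)=1+e_{0,i}u-e_{-i,0}u^*-e_{-i,i}q_0(u),\qquad u^*=b_{q_0}(u,\_),$$ where $e_{kl}a$ denotes the endomorphism of $M$ whose matrix with respect to the decomposition has the single nonzero block $a$, in row $k$ and column $l$. These endomorphisms lie in $\mathrm{O}(M,q)$; let $\mathrm{EO}(M,q)\le\mathrm{O}(M,q)$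 be the subgroup generated by all of them. Suppose that $M_0$ is a finitely generated $K$-module and that the ideal of $K$ generated by the values $q_0(w)$, $w\in M_0$, is the unit ideal. Then $\mathrm{EO}(M,q)$ is a normal subgroup of $\mathrm{O}(M,q)$. -/

import Mathlib

/-- The index set `{-2, -1, 1, 2}` of the hyperbolic basis vectors. -/
inductive HypIndex : Type
  | neg_two
  | neg_one
  | one
  | two
  deriving DecidableEq

namespace HypIndex

/-- The sign change `i ↦ -i` on `{-2, -1, 1, 2}`. -/
instance : Neg HypIndex where
  neg i := match i with
    | neg_two => two
    | neg_one => one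
    | one => neg_one
    | two => neg_two

@[simp] theorem neg_neg_two : -neg_two = two := rfl
@[simp] theorem neg_neg_one : -neg_one = one := rfl
@[simp] theorem neg_one_eq : -one = neg_one := rfl
@[simp] theorem neg_two_eq : -two = neg_two := rfl

end HypIndex

/-- The orthogonal group `O(M, q)`: the `K`-linear automorphisms of `M` that preserve `q`. -/
def quadraticOrthogonalGroup {K M : Type*} [CommRing K] [AddCommGroup M] [Module K M]
    (q : QuadraticForm K M) : Subgroup (M ≃ₗ[K] M) where
  carrier := {φ | ∀ x, q (φ x) = q x}
  one_mem' := fun _ => rfl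
  mul_mem' := fun {φ ψ} hφ hψ x => (hφ (ψ x)).trans (hψ x)
  inv_mem' := fun {φ} hφ x => by
    have h := hφ (φ.symm x)
    rw [LinearEquiv.apply_symm_apply] at h
    exact h.symm

/-- A fixed decomposition `M = e₋₂K ⊕ e₋₁K ⊕ M₀ ⊕ e₁K ⊕ e₂K` of the quadratic module `(M, q)` such
that `q(x₋₂, x₋₁, u, x₁, x₂) = q₀(u) + x₋₁x₁ + x₋₂x₂`. -/
structure WittDecomposition {K M M₀ : Type*} [CommRing K] [AddCommGroup M] [Module K M]
    [AddCommGroup M₀] [Module K M₀] (q : QuadraticForm K M) (q₀ : QuadraticForm K M₀) where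
  equiv : ((HypIndex → K) × M₀) ≃ₗ[K] M
  map_equiv : ∀ (x : HypIndex → K) (u : M₀),
    q (equiv (x, u)) = q₀ u + x .neg_one * x .one + x .neg_two * x .two

namespace WittDecomposition

variable {K M M₀ : Type*} [CommRing K] [AddCommGroup M] [Module K M]
  [AddCommGroup M₀] [Module K M₀] {q : QuadraticForm K M} {q₀ : QuadraticForm K M₀}

/-- The embedding `ι_i : K → M`, `a ↦ e_i a`, for `i ∈ {±1, ±2}`. -/
def incl (D : WittDecomposition q q₀) (i : HypIndex) : K →ₗ[K] M :=
  D.equiv.toLinearMap ∘ₗ LinearMap.inl K (HypIndex → K) M₀ ∘ₗ LinearMap.single K (fun _ => K) i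

/-- The embedding `ι_0 : M₀ → M`. -/
def inclZero (D : WittDecomposition q q₀) : M₀ →ₗ[K] M :=
  D.equiv.toLinearMap ∘ₗ LinearMap.inr K (HypIndex → K) M₀

/-- The projection `π_i : M → K` for `i ∈ {±1, ±2}`. -/
def proj (D : WittDecomposition q q₀) (i : HypIndex) : M →ₗ[K] K :=
  LinearMap.proj i ∘ₗ LinearMap.fst K (HypIndex → K) M₀ ∘ₗ D.equiv.symm.toLinearMap

/-- The projection `π_0 : M → M₀`. -/
def projZero (D : WittDecomposition q q₀) : M →ₗ[K] M₀ :=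
  LinearMap.snd K (HypIndex → K) M₀ ∘ₗ D.equiv.symm.toLinearMap

@[simp] theorem proj_incl (D : WittDecomposition q q₀) (i j : HypIndex) (a : K) :
    D.proj i (D.incl j a) = if i = j then a else 0 := by
  simp [proj, incl, Pi.single_apply]

@[simp] theorem projZero_incl (D : WittDecomposition q q₀) (j : HypIndex) (a : K) :
    D.projZero (D.incl j a) = 0 := by
  simp [projZero, incl]

@[simp] theorem proj_inclZero (D : WittDecomposition q q₀) (i : HypIndex) (u : M₀) :
    D.proj i (D.inclZero u) = 0 := by
  simp [proj, inclZero]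

@[simp] theorem projZero_inclZero (D : WittDecomposition q q₀) (u : M₀) :
    D.projZero (D.inclZero u) = u := by
  simp [projZero, inclZero]

theorem apply_eq (D : WittDecomposition q q₀) (x : M) :
    q x = q₀ (D.projZero x) + D.proj .neg_one x * D.proj .one x
      + D.proj .neg_two x * D.proj .two x := by
  have h := D.map_equiv (D.equiv.symm x).1 (D.equiv.symm x).2
  rw [Prod.mk.eta, LinearEquiv.apply_symm_apply] at h
  exact h

theorem ext_proj (D : WittDecomposition q q₀) {x y : M}
    (h : ∀ i, D.proj i x = D.proj i y) (h₀ : D.projZero x = D.projZero y) : x = y :=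
  D.equiv.symm.injective (Prod.ext (funext h) h₀)

/-- The endomorphism `1 + e_{ij} y - e_{-j,-i} y` of `M`. -/
def transvectionMap (D : WittDecomposition q q₀) (i j : HypIndex) (y : K) : M →ₗ[K] M :=
  LinearMap.id + y • (D.incl i ∘ₗ D.proj j) - y • (D.incl (-j) ∘ₗ D.proj (-i))

/-- The endomorphism `1 + e_{0,i} u - e_{-i,0} u^* - e_{-i,i} q₀(u)` of `M`, where
`u^* = b_{q₀}(u, _)`. -/
def transvectionZeroMap (D : WittDecomposition q q₀) (i : HypIndex) (u : M₀) : M →ₗ[K] M :=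
  LinearMap.id + D.inclZero ∘ₗ (D.proj i).smulRight u
    - D.incl (-i) ∘ₗ q₀.polarBilin u ∘ₗ D.projZero - q₀ u • (D.incl (-i) ∘ₗ D.proj i)

theorem transvectionMap_neg_apply (D : WittDecomposition q q₀) {i j : HypIndex}
    (hij : i ≠ j) (hij' : i ≠ -j) (y : K) (x : M) :
    D.transvectionMap i j (-y) (D.transvectionMap i j y x) = x := by
  apply D.ext_proj
  · intro k
    cases i <;> cases j <;> simp_all <;> cases k <;> simp [transvectionMap]
  · simp [transvectionMap]

theorem transvectionZeroMap_neg_apply (D : WittDecomposition q q₀) (i : HypIndex) (u : M₀)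
    (x : M) : D.transvectionZeroMap i (-u) (D.transvectionZeroMap i u x) = x := by
  have h : QuadraticMap.polar q₀ u u = 2 * q₀ u := by
    simp [two_mul, two_smul]
  apply D.ext_proj
  · intro k
    cases i <;> cases k <;> simp [transvectionZeroMap, h] <;> ring
  · cases i <;> simp [transvectionZeroMap]

theorem map_transvectionMap (D : WittDecomposition q q₀) {i j : HypIndex}
    (hij : i ≠ j) (hij' : i ≠ -j) (y : K) (x : M) :
    q (D.transvectionMap i j y x) = q x := by
  rw [D.apply_eq, D.apply_eq x]
  cases i <;> cases j <;> simp_all [transvectionMap] <;> ring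

theorem map_transvectionZeroMap (D : WittDecomposition q q₀) (i : HypIndex) (u : M₀) (x : M) :
    q (D.transvectionZeroMap i u x) = q x := by
  have h : ∀ (a : K) (v : M₀),
      q₀ (v + a • u) = q₀ v + a * a * q₀ u + a * QuadraticMap.polar q₀ u v := by
    intro a v
    rw [QuadraticMap.map_add q₀, QuadraticMap.map_smul, QuadraticMap.polar_smul_right,
      QuadraticMap.polar_comm, smul_eq_mul, smul_eq_mul]
  rw [D.apply_eq, D.apply_eq x]
  cases i <;> simp [transvectionZeroMap, h] <;> ring

/-- The elementary transvection `T_{ij}(y) = 1 + e_{ij} y - e_{-j,-i} y` in `O(M, q)`, where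
`y ∈ K`, `i, j ∈ {±1, ±2}` and `i ≠ ±j`. -/
def transvection (D : WittDecomposition q q₀) (i j : HypIndex) (hij : i ≠ j) (hij' : i ≠ -j)
    (y : K) : quadraticOrthogonalGroup q :=
  ⟨{ D.transvectionMap i j y with
      invFun := D.transvectionMap i j (-y)
      left_inv := D.transvectionMap_neg_apply hij hij' y
      right_inv := fun x => by
        have h := D.transvectionMap_neg_apply hij hij' (-y) x
        rw [neg_neg] at h
        exact h },
    D.map_transvectionMap hij hij' y⟩

/-- The elementary transvection `T_i(u) = 1 + e_{0,i} u - e_{-i,0} u^* - e_{-i,i} q₀(u)` in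
`O(M, q)`, where `u ∈ M₀` and `i ∈ {±1, ±2}`. -/
def transvectionZero (D : WittDecomposition q q₀) (i : HypIndex) (u : M₀) :
    quadraticOrthogonalGroup q :=
  ⟨{ D.transvectionZeroMap i u with
      invFun := D.transvectionZeroMap i (-u)
      left_inv := D.transvectionZeroMap_neg_apply i u
      right_inv := fun x => by
        have h := D.transvectionZeroMap_neg_apply i (-u) x
        rw [neg_neg] at h
        exact h },
    D.map_transvectionZeroMap i u⟩

/-- The elementary subgroup `EO(M, q)` of `O(M, q)`, generated by all `T_{ij}(y)` and `T_i(u)`. -/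
def elementarySubgroup (D : WittDecomposition q q₀) : Subgroup (quadraticOrthogonalGroup q) :=
  Subgroup.closure
    ({g | ∃ (i j : HypIndex) (hij : i ≠ j) (hij' : i ≠ -j) (y : K),
        g = D.transvection i j hij hij' y} ∪
      {g | ∃ (i : HypIndex) (u : M₀), g = D.transvectionZero i u})

end WittDecomposition

/-! Every generator is an Eichler transvection E(e_i, v) with v orthogonal to e_i, and conjugation
by g turns it into E(g e_i, g v). So it suffices that E(u, v) is elementary whenever u is isotropic,
pairs to 1 with some vector, and v is orthogonal to u (`isElementary_of_polar_eq_one`). Since E(u,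
v) is additive in v on the orthogonal complement of u, the scalars s for which all E(u, s v) are
elementary form an ideal. Its radical contains each hyperbolic coordinate of u
(`isElementary_pow_smul`) and each value of the polar form of q₀ at the M₀-component of u. The
pairing equal to 1 is a combination of these, so the ideal is the unit ideal. For the coordinates, a
power of u_j times v is written through vectors supported on few coordinates. The hard input is
`isElementary_plane_dual`: E(u, q(v)w) measures the failure of additivity of E in its first
argument. Taking v in M₀ gives scalars q₀(m), and these generate the unit ideal. -/

namespace HypIndex

instance : InvolutiveNeg HypIndex where
  neg_neg i := by cases i <;> rfl

theorem neg_ne_self (i : HypIndex) : -i ≠ i := by cases i <;> decide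

theorem exists_ne_ne_neg (j : HypIndex) : ∃ k : HypIndex, k ≠ j ∧ k ≠ -j := by
  cases j
  · exact ⟨one, by decide, by decide⟩
  · exact ⟨two, by decide, by decide⟩
  · exact ⟨two, by decide, by decide⟩
  · exact ⟨one, by decide, by decide⟩

end HypIndex

/-! ### Identities between Eichler transvections -/

section Eichler

open QuadraticMap

variable {K M : Type*} [CommRing K] [AddCommGroup M] [Module K M] {q : QuadraticForm K M}

/-- The Eichler–Siegel–Dickson transvection `E(u, v)`, an isometry when `u` is isotropic and
orthogonal to `v`. -/
def eichler (q : QuadraticForm K M) (u v x : M) : M :=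
  x + polar q v x • u - polar q u x • v - (q v * polar q u x) • u

theorem QuadraticMap.polar_self_eq_zero {u : M} (hu : q u = 0) : polar q u u = 0 := by
  rw [QuadraticMap.polar_self, hu, smul_zero]

theorem eichler_add_right {u v w : M} (hu : q u = 0) (hv : polar q u v = 0)
    (hw : polar q u w = 0) (x : M) :
    eichler q u v (eichler q u w x) = eichler q u (v + w) x := by
  have hv' : polar q v u = 0 := by rw [polar_comm, hv]
  have huu := polar_self_eq_zero hu
  simp only [eichler, QuadraticMap.map_add q, polar_add_right, polar_sub_right,
    polar_smul_right, polar_add_left, huu, hv', hw, smul_eq_mul]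
  module

theorem eichler_smul_left (a : K) (u v x : M) :
    eichler q (a • u) v x = eichler q u (a • v) x := by
  simp only [eichler, polar_smul_left, QuadraticMap.map_smul, smul_eq_mul]
  module

/-- Without the quadratic term, E(u, v) depends only on the bivector u ∧ v. -/
theorem eichler_swap {u v : M} (hu : q u = 0) (hv : q v = 0) (x : M) :
    eichler q v (-u) x = eichler q u v x := by
  simp only [eichler, polar_neg_left, QuadraticMap.map_neg, hu, hv]
  module

theorem eichler_smul_self {u : M} (hu : q u = 0) (a : K) (x : M) :
    eichler q u (a • u) x = x := by
  simp only [eichler, polar_smul_left, QuadraticMap.map_smul, hu, smul_eq_mul]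
  module

/-- The term quadratic in v obstructs additivity in the first argument; the defect is again a
transvection, in the plane of u and w. -/
theorem eichler_add_left {u w v : M} (hu : q u = 0) (hw : q w = 0) (huw : polar q u w = 0)
    (huv : polar q u v = 0) (hwv : polar q w v = 0) (x : M) :
    eichler q u (q v • w) (eichler q u v (eichler q w v x)) = eichler q (u + w) v x := by
  have huu := polar_self_eq_zero hu
  have hww := polar_self_eq_zero hw
  have hwu : polar q w u = 0 := by rw [polar_comm, huw]
  have hvw : polar q v w = 0 := by rw [polar_comm, hwv]
  have hvv : polar q v v = 2 * q v := by rw [QuadraticMap.polar_self, two_smul, two_mul]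
  simp only [eichler, QuadraticMap.map_smul, polar_add_right, polar_sub_right,
    polar_smul_right, polar_add_left, polar_smul_left, huu, hww, huw, hwu, hvw, huv, hwv, hvv,
    hw, smul_eq_mul]
  module

theorem polar_orthogonal (g : quadraticOrthogonalGroup q) (x y : M) :
    polar q (g.1 x) (g.1 y) = polar q x y := by
  simp only [polar, ← map_add]
  rw [g.2, g.2, g.2]

theorem orthogonal_eichler (g : quadraticOrthogonalGroup q) (u v x : M) :
    g.1 (eichler q u v x) = eichler q (g.1 u) (g.1 v) (g.1 x) := by
  simp only [eichler, map_add, map_sub, map_smul, polar_orthogonal]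
  rw [g.2]

end Eichler

/-! ### Coordinates, and the generators as transvections -/

namespace WittDecomposition

open QuadraticMap

variable {K M M₀ : Type*} [CommRing K] [AddCommGroup M] [Module K M]
  [AddCommGroup M₀] [Module K M₀] {q : QuadraticForm K M} {q₀ : QuadraticForm K M₀}

/-- The hyperbolic basis vector `e_i`. -/
def e (D : WittDecomposition q q₀) (i : HypIndex) : M := D.incl i 1

theorem incl_eq (D : WittDecomposition q q₀) (i : HypIndex) (a : K) : D.incl i a = a • D.e i := by
  rw [e, ← map_smul, smul_eq_mul, mul_one]

@[simp] theorem proj_e (D : WittDecomposition q q₀) (i j : HypIndex) :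
    D.proj i (D.e j) = if i = j then 1 else 0 := D.proj_incl i j 1

@[simp] theorem projZero_e (D : WittDecomposition q q₀) (j : HypIndex) :
    D.projZero (D.e j) = 0 := D.projZero_incl j 1

@[simp] theorem map_e (D : WittDecomposition q q₀) (i : HypIndex) : q (D.e i) = 0 := by
  rw [D.apply_eq]
  cases i <;> simp

@[simp] theorem map_inclZero (D : WittDecomposition q q₀) (m : M₀) :
    q (D.inclZero m) = q₀ m := by
  rw [D.apply_eq]
  simp

theorem polar_eq (D : WittDecomposition q q₀) (x y : M) :
    polar q x y = polar q₀ (D.projZero x) (D.projZero y)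
      + D.proj .neg_one x * D.proj .one y + D.proj .one x * D.proj .neg_one y
      + D.proj .neg_two x * D.proj .two y + D.proj .two x * D.proj .neg_two y := by
  simp only [polar, D.apply_eq, map_add]
  ring

@[simp] theorem polar_e_left (D : WittDecomposition q q₀) (i : HypIndex) (x : M) :
    polar q (D.e i) x = D.proj (-i) x := by
  rw [D.polar_eq]
  cases i <;> simp

@[simp] theorem polar_e_right (D : WittDecomposition q q₀) (i : HypIndex) (x : M) :
    polar q x (D.e i) = D.proj (-i) x := by
  rw [polar_comm, polar_e_left]

@[simp] theorem polar_inclZero_left (D : WittDecomposition q q₀) (m : M₀) (x : M) :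
    polar q (D.inclZero m) x = polar q₀ m (D.projZero x) := by
  rw [D.polar_eq]
  simp

@[simp] theorem polar_inclZero_right (D : WittDecomposition q q₀) (m : M₀) (x : M) :
    polar q x (D.inclZero m) = polar q₀ (D.projZero x) m := by
  rw [polar_comm, polar_inclZero_left, polar_comm]

theorem eq_sum_e (D : WittDecomposition q q₀) {j k : HypIndex} (hkj : k ≠ j) (hkj' : k ≠ -j)
    (x : M) : x = D.inclZero (D.projZero x) + D.proj j x • D.e j + D.proj (-j) x • D.e (-j)
      + D.proj k x • D.e k + D.proj (-k) x • D.e (-k) := by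
  apply D.ext_proj
  · intro i
    cases k <;> cases j <;> first | exact absurd rfl hkj | exact absurd rfl hkj' | skip
    all_goals cases i <;> simp
  · simp

/-- The transvection `E(u, v)` belongs to the elementary subgroup. -/
def IsElementary (D : WittDecomposition q q₀) (u v : M) : Prop :=
  ∃ g ∈ D.elementarySubgroup, ∀ x, g.1 x = eichler q u v x

theorem transvection_apply (D : WittDecomposition q q₀) {i j : HypIndex} (hij : i ≠ j)
    (hij' : i ≠ -j) (y : K) (x : M) :
    (D.transvection i j hij hij' y).1 x = eichler q (D.e i) (y • D.e (-j)) x := by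
  change D.transvectionMap i j y x = _
  simp only [transvectionMap, eichler, LinearMap.add_apply, LinearMap.sub_apply, LinearMap.id_apply,
    LinearMap.smul_apply, LinearMap.comp_apply, incl_eq, polar_smul_left, polar_e_left, neg_neg,
    QuadraticMap.map_smul, map_e, smul_eq_mul]
  module

theorem transvectionZero_apply (D : WittDecomposition q q₀) (i : HypIndex) (u : M₀) (x : M) :
    (D.transvectionZero i u).1 x = eichler q (D.e (-i)) (-D.inclZero u) x := by
  change D.transvectionZeroMap i u x = _
  simp only [transvectionZeroMap, eichler, LinearMap.add_apply, LinearMap.sub_apply,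
    LinearMap.id_apply, LinearMap.smul_apply, LinearMap.comp_apply, incl_eq, polar_neg_left,
    polar_e_left, neg_neg, QuadraticMap.map_neg, map_inclZero, polar_inclZero_left,
    LinearMap.smulRight_apply, map_smul, polarBilin_apply_apply]
  module

theorem isElementary_e_e (D : WittDecomposition q q₀) {i j : HypIndex} (hij : i ≠ -j) (a : K) :
    D.IsElementary (D.e i) (a • D.e j) := by
  by_cases h : i = j
  · subst h
    exact ⟨1, one_mem _, fun x => (eichler_smul_self (D.map_e i) a x).symm⟩
  · refine ⟨D.transvection i (-j) hij (by rwa [neg_neg]) a, Subgroup.subset_closure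
      (Or.inl ⟨i, -j, _, _, a, rfl⟩), fun x => ?_⟩
    rw [transvection_apply, neg_neg]

theorem isElementary_e_inclZero (D : WittDecomposition q q₀) (i : HypIndex) (m : M₀) :
    D.IsElementary (D.e i) (D.inclZero m) := by
  refine ⟨D.transvectionZero (-i) (-m), Subgroup.subset_closure (Or.inr ⟨_, _, rfl⟩), fun x => ?_⟩
  rw [transvectionZero_apply, neg_neg, map_neg, neg_neg]

/-! ### Closure properties of elementary transvections -/

namespace IsElementary

variable {D : WittDecomposition q q₀} {u v w : M}

theorem add (hv : D.IsElementary u v) (hw : D.IsElementary u w) (hu : q u = 0)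
    (huv : polar q u v = 0) (huw : polar q u w = 0) : D.IsElementary u (v + w) := by
  obtain ⟨g, hg, hgx⟩ := hv
  obtain ⟨h, hh, hhx⟩ := hw
  refine ⟨g * h, mul_mem hg hh, fun x => ?_⟩
  change g.1 (h.1 x) = _
  rw [hgx, hhx, eichler_add_right hu huv huw]

theorem neg (hv : D.IsElementary u v) (hu : q u = 0) (huv : polar q u v = 0) :
    D.IsElementary u (-v) := by
  obtain ⟨g, hg, hgx⟩ := hv
  refine ⟨g⁻¹, inv_mem hg, fun x => ?_⟩
  apply g.1.injective
  have h1 : g.1 (g⁻¹.1 x) = x := g.1.apply_symm_apply x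
  rw [h1, hgx, eichler_add_right hu huv (by rw [polar_neg_right, huv, neg_zero])]
  simp [eichler]

theorem conj (h : D.IsElementary u v) {g : quadraticOrthogonalGroup q}
    (hg : g ∈ D.elementarySubgroup) : D.IsElementary (g.1 u) (g.1 v) := by
  obtain ⟨t, ht, htx⟩ := h
  refine ⟨g * t * g⁻¹, mul_mem (mul_mem hg ht) (inv_mem hg), fun x => ?_⟩
  have h1 : g.1 (g⁻¹.1 x) = x := g.1.apply_symm_apply x
  change g.1 (t.1 (g⁻¹.1 x)) = _
  rw [htx, orthogonal_eichler, h1]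

theorem of_conj {g : quadraticOrthogonalGroup q} (hg : g ∈ D.elementarySubgroup)
    (h : D.IsElementary (g.1 u) (g.1 v)) : D.IsElementary u v := by
  have := h.conj (inv_mem hg)
  have h1 : ∀ x, g⁻¹.1 (g.1 x) = x := fun x => g.1.symm_apply_apply x
  rwa [h1, h1] at this

theorem swap (h : D.IsElementary u v) (hu : q u = 0) (hv : q v = 0) : D.IsElementary v (-u) := by
  obtain ⟨g, hg, hgx⟩ := h
  exact ⟨g, hg, fun x => by rw [hgx, eichler_swap hu hv]⟩

theorem smul_left_iff {a : K} : D.IsElementary (a • u) v ↔ D.IsElementary u (a • v) := by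
  simp only [IsElementary, eichler_smul_left]

theorem smul_self (hu : q u = 0) (a : K) : D.IsElementary u (a • u) :=
  ⟨1, one_mem _, fun x => (eichler_smul_self hu a x).symm⟩

theorem add_left (hu : q u = 0) (hw : q w = 0) (huw : polar q u w = 0)
    (huv : polar q u v = 0) (hwv : polar q w v = 0) (h₁ : D.IsElementary u v)
    (h₂ : D.IsElementary w v) (h₃ : D.IsElementary u (q v • w)) : D.IsElementary (u + w) v := by
  obtain ⟨g₁, hg₁, hgx₁⟩ := h₁
  obtain ⟨g₂, hg₂, hgx₂⟩ := h₂
  obtain ⟨g₃, hg₃, hgx₃⟩ := h₃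
  refine ⟨g₃ * g₁ * g₂, mul_mem (mul_mem hg₃ hg₁) hg₂, fun x => ?_⟩
  change g₃.1 (g₁.1 (g₂.1 x)) = _
  rw [hgx₁, hgx₂, hgx₃, eichler_add_left hu hw huw huv hwv]

theorem of_add_left (hu : q u = 0) (hw : q w = 0) (huw : polar q u w = 0)
    (huv : polar q u v = 0) (hwv : polar q w v = 0) (h₁ : D.IsElementary u v)
    (h₂ : D.IsElementary w v) (h₃ : D.IsElementary (u + w) v) : D.IsElementary u (q v • w) := by
  obtain ⟨g₁, hg₁, hgx₁⟩ := h₁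
  obtain ⟨g₂, hg₂, hgx₂⟩ := h₂
  obtain ⟨g₃, hg₃, hgx₃⟩ := h₃
  refine ⟨g₃ * (g₁ * g₂)⁻¹, mul_mem hg₃ (inv_mem (mul_mem hg₁ hg₂)), fun x => ?_⟩
  obtain ⟨y, rfl⟩ := (g₁ * g₂).1.surjective x
  have h1 : (g₁ * g₂)⁻¹.1 ((g₁ * g₂).1 y) = y := (g₁ * g₂).1.symm_apply_apply y
  change g₃.1 ((g₁ * g₂)⁻¹.1 ((g₁ * g₂).1 y)) = eichler q u _ (g₁.1 (g₂.1 y))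
  rw [h1, hgx₁, hgx₂, hgx₃, eichler_add_left hu hw huw huv hwv]

end IsElementary

/-! ### Transvections along vectors of hyperbolic coordinate planes -/

theorem map_plane (D : WittDecomposition q q₀) {i j : HypIndex} (hij' : i ≠ -j) (a b : K) :
    q (a • D.e i + b • D.e j) = 0 := by
  have h : -j ≠ i := hij'.symm
  rw [QuadraticMap.map_add q, QuadraticMap.map_smul, QuadraticMap.map_smul]
  simp [h]

theorem isElementary_plane_e (D : WittDecomposition q q₀) {i j k : HypIndex} (hij' : i ≠ -j)
    (hk : i ≠ -k) (hk' : j ≠ -k) (a b c : K) :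
    D.IsElementary (a • D.e i + b • D.e j) (c • D.e k) := by
  have hij : -j ≠ i := hij'.symm
  refine IsElementary.add_left (by simp [QuadraticMap.map_smul])
    (by simp [QuadraticMap.map_smul]) (by simp [hij]) (by simp [hk.symm]) (by simp [hk'.symm])
    ?_ ?_ ?_
  · rw [IsElementary.smul_left_iff, smul_smul]
    exact D.isElementary_e_e hk _
  · rw [IsElementary.smul_left_iff, smul_smul]
    exact D.isElementary_e_e hk' _
  · rw [QuadraticMap.map_smul, map_e, smul_zero, zero_smul,
      ← zero_smul K (a • D.e i)]
    exact IsElementary.smul_self (by simp [QuadraticMap.map_smul]) 0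

theorem isElementary_plane_inclZero (D : WittDecomposition q q₀) {i j : HypIndex} (hij' : i ≠ -j)
    (a b : K) (m : M₀) : D.IsElementary (a • D.e i + b • D.e j) (D.inclZero m) := by
  have hij : -j ≠ i := hij'.symm
  refine IsElementary.add_left (by simp [QuadraticMap.map_smul])
    (by simp [QuadraticMap.map_smul]) (by simp [hij]) (by simp) (by simp) ?_ ?_ ?_
  · rw [IsElementary.smul_left_iff, ← map_smul]
    exact D.isElementary_e_inclZero _ _
  · rw [IsElementary.smul_left_iff, ← map_smul]
    exact D.isElementary_e_inclZero _ _
  · rw [map_inclZero, IsElementary.smul_left_iff, smul_smul, smul_smul]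
    exact D.isElementary_e_e hij' _

/-- With u the plane vector, w the multiple by c of its dual, and v = m in M₀, this is the defect of
additivity E(u, q(v)w). It is elementary because the transvections along u, w and u + w in the
direction m are. -/
theorem isElementary_plane_dual_map (D : WittDecomposition q q₀) {i j : HypIndex} (hij : i ≠ j)
    (hij' : i ≠ -j) (a b c : K) (m : M₀) :
    D.IsElementary (a • D.e i + b • D.e j)
      (q₀ m • c • (a • D.e (-j) + (-b) • D.e (-i))) := by
  have h₁ : -i ≠ j := fun h => hij' (by rw [← h, neg_neg])
  have h₂ : -j ≠ i := fun h => hij' (by rw [← h])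
  have h₃ : -i ≠ -j := fun h => hij (neg_injective h)
  have h₄ : -j ≠ -i := h₃.symm
  have key := IsElementary.of_add_left (D := D) (u := a • D.e i + b • D.e j)
    (w := c • (a • D.e (-j) + (-b) • D.e (-i))) (v := D.inclZero m)
    (D.map_plane hij' a b)
    (by rw [QuadraticMap.map_smul, D.map_plane (by rwa [neg_neg]), smul_zero])
    (by
      simp only [polar_add_left, polar_smul_left, polar_e_left, map_add, map_smul, proj_e,
        polar_smul_right, if_true, if_neg h₃, if_neg h₄, smul_eq_mul]
      ring)
    (by simp) (by simp)
    (D.isElementary_plane_inclZero hij' a b m)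
    (by
      rw [IsElementary.smul_left_iff, ← map_smul]
      exact D.isElementary_plane_inclZero (by rwa [neg_neg]) _ _ _)
  rw [map_inclZero] at key
  apply key
  -- This g sends u to u + w and fixes M₀, so E(u + w, m) is a conjugate of E(u, m).
  obtain ⟨g, hg, hgx⟩ := D.isElementary_e_e (i := -j) (j := -i) (by rwa [neg_neg]) c
  have h₅ := (D.isElementary_plane_inclZero hij' a b m).conj hg
  convert h₅ using 1
  · simp only [hgx, map_add, map_smul, eichler, polar_smul_left, polar_e_left, neg_neg, proj_e,
      QuadraticMap.map_smul, map_e, if_true, if_neg hij, if_neg hij.symm, smul_eq_mul]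
    module
  · simp [hgx, eichler]

theorem isElementary_plane_dual (D : WittDecomposition q q₀)
    (hq₀ : Ideal.span (Set.range fun w : M₀ => q₀ w) = ⊤) {i j : HypIndex} (hij : i ≠ j)
    (hij' : i ≠ -j) (a b c : K) :
    D.IsElementary (a • D.e i + b • D.e j) (c • (a • D.e (-j) + (-b) • D.e (-i))) := by
  have h₃ : -i ≠ -j := fun h => hij (neg_injective h)
  have hu := D.map_plane hij' a b
  have hp : ∀ d : K, polar q (a • D.e i + b • D.e j)
      (d • (a • D.e (-j) + (-b) • D.e (-i))) = 0 := by
    intro d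
    simp only [polar_add_left, polar_smul_left, polar_e_left, map_add, map_smul, proj_e,
        polar_smul_right, if_true, if_neg h₃, if_neg h₃.symm, smul_eq_mul]
    ring
  -- Additivity in the second argument reduces an arbitrary c to multiples of values of q₀.
  have hmem : c ∈ Ideal.span (Set.range fun w : M₀ => q₀ w) := hq₀ ▸ Submodule.mem_top
  induction hmem using Submodule.closure_induction with
  | zero => simpa using IsElementary.smul_self hu 0
  | add x y _ _ hx hy =>
    rw [add_smul]
    exact hx.add hy hu (hp x) (hp y)
  | smul_mem r x hx =>
    obtain ⟨w, rfl⟩ := hx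
    change D.IsElementary _ ((r * q₀ w) • _)
    rw [mul_comm, mul_smul]
    exact D.isElementary_plane_dual_map hij hij' a b r w

/-- For an isotropic vector `u` the transvection along `u` in the direction of the component
`u_j e_k - u_{-k} e_{-j}` of `u ∧ (e_k ∧ e_{-j})` is elementary. -/
theorem isElementary_plane_of_isotropic (D : WittDecomposition q q₀)
    (hq₀ : Ideal.span (Set.range fun w : M₀ => q₀ w) = ⊤) {j k : HypIndex} (hkj : k ≠ j)
    (hkj' : k ≠ -j) {u : M} (hu : q u = 0) (a : K) :
    D.IsElementary u (a • (D.proj j u • D.e k + (-D.proj (-k) u) • D.e (-j))) := by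
  have h₁ : -k ≠ j := fun h => hkj' (by rw [← h, neg_neg])
  have h₂ : -k ≠ -j := fun h => hkj (neg_injective h)
  set s := D.proj j u
  set t := D.proj (-k) u
  have hf : q (s • D.e k + (-t) • D.e (-j)) = 0 := D.map_plane (by rwa [neg_neg]) _ _
  -- The plane vector f is isotropic, so E(u, a f) = E(f, -a u). Now -a u splits into its M₀-part, a
  -- multiple of the dual of f, and a vector in the plane of f.
  suffices h : D.IsElementary (s • D.e k + (-t) • D.e (-j)) ((-a) • u) by
    have := h.swap hf (by rw [QuadraticMap.map_smul, hu, smul_zero])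
    rw [IsElementary.smul_left_iff] at this
    simpa [add_comm] using this
  have hdec : (-a) • u = D.inclZero ((-a) • D.projZero u)
      + (-a) • (s • D.e (-(-j)) + (-(-t)) • D.e (-k))
      + ((-a * D.proj k u) • D.e k + (-a * D.proj (-j) u) • D.e (-j)) := by
    conv_lhs => rw [D.eq_sum_e hkj hkj' u]
    rw [neg_neg, map_smul]
    module
  rw [hdec]
  have e₁ := D.isElementary_plane_inclZero (i := k) (j := -j) (by rwa [neg_neg]) s (-t)
    ((-a) • D.projZero u)
  have e₂ := D.isElementary_plane_dual hq₀ (i := k) (j := -j) hkj' (by rwa [neg_neg]) s (-t) (-a)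
  have e₃ := D.isElementary_plane_e (i := k) (j := -j) (k := k) (by rwa [neg_neg])
    (HypIndex.neg_ne_self k).symm h₂.symm s (-t) (-a * D.proj k u)
  have e₄ := D.isElementary_plane_e (i := k) (j := -j) (k := -j) (by rwa [neg_neg])
    (by rwa [neg_neg]) (HypIndex.neg_ne_self _).symm s (-t) (-a * D.proj (-j) u)
  refine (e₁.add e₂ hf ?_ ?_).add (e₃.add e₄ hf ?_ ?_) hf ?_ ?_
  all_goals
    simp [h₂, hkj.symm, hkj', hkj'.symm, HypIndex.neg_ne_self,
      (HypIndex.neg_ne_self _).symm]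
  all_goals ring

/-! ### Arbitrary isotropic vectors, up to a power of a coordinate -/

/-- A commutator argument: g = E(f, n), with f and n orthogonal to u, fixes u and moves the plane
vector along e_k and e_{-j} by -s² n plus a multiple of f. Cancelling the known directions from the
conjugate of E(u, _) leaves the direction s² n. -/
theorem isElementary_sq_smul_inclZero (D : WittDecomposition q q₀)
    (hq₀ : Ideal.span (Set.range fun w : M₀ => q₀ w) = ⊤) (j : HypIndex)
    {u : M} (hu : q u = 0) (a : K) (m : M₀) :
    D.IsElementary u ((a * D.proj j u ^ 2) •
      (D.inclZero (D.proj j u • m) + (-polar q₀ (D.projZero u) m) • D.e (-j))) := by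
  obtain ⟨k, hkj, hkj'⟩ := j.exists_ne_ne_neg
  have h₁ : -k ≠ j := fun h => hkj' (by rw [← h, neg_neg])
  have h₂ : -k ≠ -j := fun h => hkj (neg_injective h)
  have h₃ : j ≠ -j := (HypIndex.neg_ne_self j).symm
  have h₄ : -k ≠ k := HypIndex.neg_ne_self k
  have E₁ := D.isElementary_plane_of_isotropic hq₀ hkj hkj' hu
  have E₂ := D.isElementary_plane_of_isotropic hq₀ (k := -k) h₁ h₂ hu
  rw [neg_neg] at E₂
  set s := D.proj j u with hs
  set t := D.proj (-k) u with ht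
  set r := D.proj k u with hr
  set p := polar q₀ (D.projZero u) m with hp
  have hf : q (s • D.e (-k) + (-r) • D.e (-j)) = 0 :=
    D.map_plane (by rwa [neg_neg]) _ _
  have hn : D.IsElementary (s • D.e (-k) + (-r) • D.e (-j))
      (D.inclZero (s • m) + (-p) • D.e (-j)) := by
    refine (D.isElementary_plane_inclZero (by rwa [neg_neg]) _ _ _).add
      (D.isElementary_plane_e (by rwa [neg_neg]) (by rwa [neg_neg])
        (by rwa [neg_neg, ne_comm]) _ _ _) hf ?_ ?_
    · simp
    · simp [h₁.symm, h₃]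
  set n := D.inclZero (s • m) + (-p) • D.e (-j) with hndef
  set f := s • D.e (-k) + (-r) • D.e (-j) with hfdef
  have hfu : polar q f u = 0 := by
    simp only [hfdef, polar_add_left, polar_smul_left, polar_e_left, neg_neg, smul_eq_mul, ← hs,
      ← hr]
    ring
  have hnu : polar q n u = 0 := by
    simp only [hndef, polar_add_left, polar_smul_left, polar_e_left, neg_neg, smul_eq_mul, ← hs,
      map_smul, polar_inclZero_left, polar_comm q₀ m, ← hp]
    ring
  obtain ⟨g, hg, hgx⟩ := hn
  have hgu : g.1 u = u := by
    rw [hgx, eichler, hfu, hnu]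
    module
  have E₃ := (E₁ a).conj hg
  rw [hgu] at E₃
  have hgf : g.1 (a • (s • D.e k + (-t) • D.e (-j)))
      = a • (s • D.e k + (-t) • D.e (-j)) + (-(a * s ^ 2)) • n + (-(a * q n * s ^ 2)) • f := by
    have c₁ : polar q n (s • D.e k + (-t) • D.e (-j)) = 0 := by
      simp [hndef, h₃, h₂]
    have c₂ : polar q f (s • D.e k + (-t) • D.e (-j)) = s ^ 2 := by
      simp [hfdef, h₁.symm, h₃, h₂, _root_.sq]
    rw [hgx, eichler]
    simp only [polar_smul_right, c₁, c₂, smul_eq_mul]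
    module
  rw [hgf] at E₃
  have o₁ : polar q u (s • D.e k + (-t) • D.e (-j)) = 0 := by
    simp only [polar_add_right, polar_smul_right, polar_e_right, neg_neg, smul_eq_mul, ← hs,
      ← ht]
    ring
  have o₂ : polar q u n = 0 := by rw [polar_comm, hnu]
  have o₃ : polar q u f = 0 := by rw [polar_comm, hfu]
  have E₄ := (((E₁ a).add (E₂ (-(a * q n * s ^ 2))) hu ?_ ?_).add (E₃.neg hu ?_) hu ?_ ?_)
  · convert E₄ using 1
    module
  all_goals simp only [polar_add_right, polar_neg_right, polar_smul_right, o₁, o₂, o₃]; simp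

/-- Multiples of u do not affect E(u, _), so s v may be replaced by a vector y orthogonal to u with
y_j = 0. Orthogonality then determines s y_{-j}, and s y becomes a combination of the directions
already treated. Two factors s come from this reduction, two from the M₀-direction. -/
theorem isElementary_pow_smul (D : WittDecomposition q q₀)
    (hq₀ : Ideal.span (Set.range fun w : M₀ => q₀ w) = ⊤) (j : HypIndex)
    {u v : M} (hu : q u = 0) (huv : polar q u v = 0) (a : K) :
    D.IsElementary u ((a * D.proj j u ^ 4) • v) := by
  obtain ⟨k, hkj, hkj'⟩ := j.exists_ne_ne_neg
  have h₁ : -k ≠ j := fun h => hkj' (by rw [← h, neg_neg])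
  have h₂ : -k ≠ -j := fun h => hkj (neg_injective h)
  have E₁ := D.isElementary_plane_of_isotropic hq₀ hkj hkj' hu
  have E₂ := D.isElementary_plane_of_isotropic hq₀ (k := -k) h₁ h₂ hu
  rw [neg_neg] at E₂
  have E₀ := D.isElementary_sq_smul_inclZero hq₀ j hu
  have huu := polar_self_eq_zero hu
  set s := D.proj j u with hs
  set y := s • v + (-D.proj j v) • u with hy
  have huy : polar q u y = 0 := by
    simp [hy, huu, huv]
  have hyj : D.proj j y = 0 := by
    simp [hy, ← hs]
    ring
  have hydec := D.eq_sum_e hkj hkj' y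
  rw [hyj] at hydec
  have huy' := huy
  rw [hydec] at huy'
  simp only [polar_add_right, polar_smul_right, polar_e_right, neg_neg, polar_inclZero_right,
    smul_eq_mul, ← hs] at huy'
  set n := D.inclZero (s • D.projZero y) + (-polar q₀ (D.projZero u) (D.projZero y)) • D.e (-j)
    with hn
  set f₁ := s • D.e k + (-D.proj (-k) u) • D.e (-j) with hf₁
  set f₂ := s • D.e (-k) + (-D.proj k u) • D.e (-j) with hf₂
  have hsy : s • y = n + D.proj k y • f₁ + D.proj (-k) y • f₂ := by
    have h : polar q₀ (D.projZero u) (D.projZero y) = -(D.proj (-j) y * s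
      + D.proj k y * D.proj (-k) u + D.proj (-k) y * D.proj k u) := by linear_combination huy'
    rw [hn, h, hf₁, hf₂, map_smul]
    conv_lhs => rw [hydec]
    module
  have o₁ : polar q u f₁ = 0 := by
    simp only [hf₁, polar_add_right, polar_smul_right, polar_e_right, neg_neg, smul_eq_mul, ← hs]
    ring
  have o₂ : polar q u f₂ = 0 := by
    simp only [hf₂, polar_add_right, polar_smul_right, polar_e_right, neg_neg, smul_eq_mul, ← hs]
    ring
  have o₀ : polar q u n = 0 := by
    simp only [hn, polar_add_right, polar_smul_right, polar_e_right, neg_neg, smul_eq_mul, ← hs,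
      polar_inclZero_right]
    ring
  have E₃ := (((E₀ a (D.projZero y)).add (E₁ (a * s ^ 2 * D.proj k y)) hu ?_ ?_).add
    (E₂ (a * s ^ 2 * D.proj (-k) y)) hu ?_ ?_).add
      (IsElementary.smul_self hu (a * s ^ 3 * D.proj j v)) hu ?_ ?_
  · convert E₃ using 1
    have h : (a * s ^ 4) • v = (a * s ^ 2) • s • y + (a * s ^ 3 * D.proj j v) • u := by
      rw [hy]
      module
    rw [h, hsy]
    module
  all_goals
    simp only [polar_add_right, polar_smul_right, o₁, o₂, o₀, ← hn, huu]
    simp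

/-! ### The ideal argument and conjugation of generators -/

/-- The ideal of those `s` for which all transvections `E(u, s v)` with `v` orthogonal to `u`
are elementary. -/
def elementaryIdeal (D : WittDecomposition q q₀) {u : M} (hu : q u = 0) : Ideal K where
  carrier := {s | ∀ v, polar q u v = 0 → D.IsElementary u (s • v)}
  zero_mem' := fun v _ => by simpa using IsElementary.smul_self hu 0
  add_mem' := fun {s t} hs ht v hv => by
    rw [add_smul]
    exact (hs v hv).add (ht v hv) hu (by rw [polar_smul_right, hv, smul_zero])
      (by rw [polar_smul_right, hv, smul_zero])
  smul_mem' := fun a s hs v hv => by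
    rw [smul_eq_mul, mul_comm, mul_smul]
    exact hs _ (by rw [polar_smul_right, hv, smul_zero])

theorem proj_mem_radical (D : WittDecomposition q q₀)
    (hq₀ : Ideal.span (Set.range fun w : M₀ => q₀ w) = ⊤) (j : HypIndex)
    {u : M} (hu : q u = 0) : D.proj j u ∈ (D.elementaryIdeal hu).radical := by
  refine ⟨4, fun v hv => ?_⟩
  simpa using D.isElementary_pow_smul hq₀ j hu hv 1

/-- The elementary E(e_1, m) adds this value to the coordinate u_1, up to a multiple of u_{-1}.
Conjugating by it transports the coordinate result from the moved vector back to u. -/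
theorem polar_projZero_mem_radical (D : WittDecomposition q q₀)
    (hq₀ : Ideal.span (Set.range fun w : M₀ => q₀ w) = ⊤) {u : M} (hu : q u = 0) (m : M₀) :
    polar q₀ (D.projZero u) m ∈ (D.elementaryIdeal hu).radical := by
  obtain ⟨g, hg, hgx⟩ := D.isElementary_e_inclZero .one m
  have h : D.proj .one (g.1 u) ∈ (D.elementaryIdeal hu).radical := by
    refine ⟨4, fun v hv => ?_⟩
    refine IsElementary.of_conj hg ?_
    rw [map_smul, ← one_mul (D.proj _ _ ^ 4)]
    exact D.isElementary_pow_smul hq₀ .one ((g.2 u).trans hu)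
      (by rw [polar_orthogonal, hv]) 1
  have h' : polar q₀ (D.projZero u) m = D.proj .one (g.1 u) - D.proj .one u
      + q₀ m * D.proj .neg_one u := by
    rw [hgx, polar_comm]
    simp only [eichler, polar_e_left, map_sub, map_add, map_smul, proj_e, polar_inclZero_left,
      proj_inclZero, map_inclZero, HypIndex.neg_one_eq, if_true, smul_eq_mul]
    ring
  rw [h']
  exact Ideal.add_mem _ (Ideal.sub_mem _ h (D.proj_mem_radical hq₀ _ hu))
    (Ideal.mul_mem_left _ _ (D.proj_mem_radical hq₀ _ hu))

theorem isElementary_of_polar_eq_one (D : WittDecomposition q q₀)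
    (hq₀ : Ideal.span (Set.range fun w : M₀ => q₀ w) = ⊤) {u u' v : M} (hu : q u = 0)
    (huu' : polar q u u' = 1) (huv : polar q u v = 0) : D.IsElementary u v := by
  have h : (1 : K) ∈ (D.elementaryIdeal hu).radical := by
    rw [← huu', D.polar_eq]
    have hp := fun j => D.proj_mem_radical hq₀ j hu
    exact Ideal.add_mem _ (Ideal.add_mem _ (Ideal.add_mem _ (Ideal.add_mem _
      (D.polar_projZero_mem_radical hq₀ hu _) (Ideal.mul_mem_right _ _ (hp _)))
      (Ideal.mul_mem_right _ _ (hp _))) (Ideal.mul_mem_right _ _ (hp _)))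
      (Ideal.mul_mem_right _ _ (hp _))
  obtain ⟨n, hn⟩ := h
  rw [one_pow] at hn
  simpa using hn v huv

theorem conj_mem_elementarySubgroup (D : WittDecomposition q q₀)
    (hq₀ : Ideal.span (Set.range fun w : M₀ => q₀ w) = ⊤) (g t : quadraticOrthogonalGroup q)
    (i : HypIndex) (v : M) (hv : D.proj (-i) v = 0)
    (ht : ∀ x, t.1 x = eichler q (D.e i) v x) : g * t * g⁻¹ ∈ D.elementarySubgroup := by
  obtain ⟨h, hh, hhx⟩ := D.isElementary_of_polar_eq_one hq₀ (u := g.1 (D.e i))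
    (u' := g.1 (D.e (-i))) (v := g.1 v) ((g.2 _).trans (D.map_e i))
    (by rw [polar_orthogonal]; simp) (by rw [polar_orthogonal]; simpa using hv)
  convert hh using 1
  apply Subtype.ext
  apply LinearEquiv.ext
  intro x
  have h1 : g.1 (g⁻¹.1 x) = x := g.1.apply_symm_apply x
  change g.1 (t.1 (g⁻¹.1 x)) = h.1 x
  rw [ht, orthogonal_eichler, h1, hhx]

end WittDecomposition

theorem mainTheorem2 {K M M₀ : Type*} [CommRing K] [AddCommGroup M] [Module K M]
    [AddCommGroup M₀] [Module K M₀] [Module.Finite K M₀]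
    (q : QuadraticForm K M) (q₀ : QuadraticForm K M₀) (D : WittDecomposition q q₀)
    (hq₀ : Ideal.span (Set.range fun w : M₀ => q₀ w) = ⊤) :
    D.elementarySubgroup.Normal := by
  refine ⟨fun t ht g => ?_⟩
  induction ht using Subgroup.closure_induction with
  | mem t ht =>
    obtain ⟨i, j, hij, hij', y, rfl⟩ | ⟨i, u, rfl⟩ := ht
    · refine D.conj_mem_elementarySubgroup hq₀ g _ i _ ?_ (D.transvection_apply hij hij' y)
      have h : -i ≠ -j := fun h => hij (neg_injective h)
      simp [h]
    · exact D.conj_mem_elementarySubgroup hq₀ g _ (-i) _ (by simp) (D.transvectionZero_apply i u)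
  | one => simp
  | mul x y _ _ hx hy =>
    have h : g * (x * y) * g⁻¹ = g * x * g⁻¹ * (g * y * g⁻¹) := by group
    rw [h]
    exact mul_mem hx hy
  | inv x _ hx =>
    have h : g * x⁻¹ * g⁻¹ = (g * x * g⁻¹)⁻¹ := by group
    rw [h]
    exact inv_mem hx
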